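/- Let $R$ be a finite valuation ring, that is, a finite commutative ring with identity that is local and principal (every ideal is principal). Let $\pi$ be a generator of the maximal ideal of $R$, let $q=|R/(\pi)|$ be the size of the residue field, and let $\ell$ be the nilpotency degree of $\pi$, i.e. the smallest positive integer with $\pi^\ell=0$. Assume that $q$ is odd. Let $n\ge 2$, and let $A,B\subseteq R^n$ be non-empty. Write $a\cdot b=a_1b_1+\dots+a_nb_n$ for $a,b\in R^n$, and put $$N_r(A,B)=\big|\{(a,b)\in A\times B:\ a\cdot b=r\}\big|\quad (r\in R),$$ $$A\cdot B=\{a\cdot b:\ a\in A,\ b\in B\},\qquad \delta(A)=\frac{|A|}{|R^n|},\qquad \delta(B)=\frac{|B|}{|R^n|}.$$ Then for each $r\in R$ we have $$\big|N_r(A,B)-q^{-\ell}|A||B|\big|<q^{n(\ell-1/2)}\sqrt{|A||B|}.$$ In particular, $A\cdot B=R$ whenever $\delta(A)\,\delta(B)\ge q^{-(n-2\ell)}$. -/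

import Mathlib

/-- The size `q` of the residue field of a local ring. -/
noncomputable def residueCard (R : Type*) [CommRing R] [IsLocalRing R] : ℕ :=
  Nat.card (IsLocalRing.ResidueField R)

/-- `π` is a uniformizer of the local ring `R`: it generates the maximal ideal. -/
def IsUniformizer {R : Type*} [CommRing R] [IsLocalRing R] (π : R) : Prop :=
  IsLocalRing.maximalIdeal R = Ideal.span {π}

/-- `N_r(A, B)`: the number of pairs `(a, b)` in `A × B` with `a · b = r`. -/
def dotCount {R : Type*} [CommRing R] [DecidableEq R] {n : ℕ} (r : R)
    (A B : Finset (Fin n → R)) : ℕ :=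
  ((A ×ˢ B).filter (fun p => dotProduct p.1 p.2 = r)).card

/-- `A · B = {a · b : a ∈ A, b ∈ B}`. -/
def dotSet {R : Type*} [CommRing R] {n : ℕ} (A B : Finset (Fin n → R)) : Set R :=
  {r | ∃ a ∈ A, ∃ b ∈ B, dotProduct a b = r}

/-- The density `δ(A) = |A| / |R ^ n|` of a subset `A` of `R ^ n`. -/
noncomputable def density {R : Type*} {n : ℕ} (A : Finset (Fin n → R)) : ℝ :=
  (A.card : ℝ) / (Nat.card (Fin n → R) : ℝ)

open Finset

/-! ### Ideals, annihilators and characters of the ring. -/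

section FiniteValuationRing

variable {R : Type*} [CommRing R] [IsLocalRing R]

/-! Expand the condition `a · b = r` in a primitive additive character. Frequency `s = 0` gives the
main term. For `s ≠ 0`, Cauchy–Schwarz in `a` and orthogonality reduce the sum to counting pairs in
`B` with `s • (b - b') = 0` (`norm_sum_sum_le`). The annihilator of `s` has at most `q ^ (ℓ - 1)`
elements (`card_annihilator_mul_le`), which gives the error term. -/

lemma IsUniformizer.mem_iff {π : R} (hπ : IsUniformizer π) (x : R) :
    ¬ IsUnit x ↔ π ∣ x := by
  rw [← mem_nonunits_iff, ← IsLocalRing.mem_maximalIdeal, hπ, Ideal.mem_span_singleton]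

lemma residueCard_pos [Finite R] : 0 < residueCard R :=
  have : Finite (IsLocalRing.ResidueField R) :=
    Finite.of_surjective _ (IsLocalRing.residue_surjective (R := R))
  Nat.card_pos

/-- Consecutive powers of the maximal ideal have relative index `q` until they vanish. -/
lemma IsUniformizer.relIndex_span_pow {π : R} (hπ : IsUniformizer π) {k : ℕ} (hk : π ^ k ≠ 0) :
    (Ideal.span {π ^ (k + 1)}).toAddSubgroup.relIndex (Ideal.span {π ^ k}).toAddSubgroup =
      residueCard R := by
  have hrange : (AddMonoidHom.mulLeft (π ^ k)).range = (Ideal.span {π ^ k}).toAddSubgroup := by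
    ext x
    simp only [AddMonoidHom.mem_range, AddMonoidHom.coe_mulLeft, Submodule.mem_toAddSubgroup,
      Ideal.mem_span_singleton]
    exact ⟨fun ⟨y, hy⟩ => ⟨y, hy.symm⟩, fun ⟨y, hy⟩ => ⟨y, hy.symm⟩⟩
  have hcomap : (Ideal.span {π ^ (k + 1)}).toAddSubgroup.comap (AddMonoidHom.mulLeft (π ^ k)) =
      (IsLocalRing.maximalIdeal R).toAddSubgroup := by
    ext x
    simp only [AddSubgroup.mem_comap, AddMonoidHom.coe_mulLeft, Submodule.mem_toAddSubgroup,
      Ideal.mem_span_singleton, IsLocalRing.mem_maximalIdeal, mem_nonunits_iff]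
    -- If `x` were a unit, so would be `x - π * y`, yet it kills `π ^ k`.
    refine ⟨fun ⟨y, hy⟩ hx => hk ?_, fun hx => ?_⟩
    · have hunit : IsUnit (x - π * y) := by
        by_contra h
        refine (hπ.mem_iff x).2 ?_ hx
        exact (dvd_sub_left (dvd_mul_right π y)).1 ((hπ.mem_iff _).1 h)
      refine (hunit.mul_left_eq_zero).1 ?_
      rw [mul_sub, hy]; ring
    · obtain ⟨y, rfl⟩ := (hπ.mem_iff x).1 hx
      exact ⟨y, by ring⟩
  rw [← hrange, ← AddSubgroup.index_comap, hcomap]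
  rfl

lemma IsUniformizer.index_span_pow {π : R} (hπ : IsUniformizer π) {ℓ : ℕ}
    (hℓ : ∀ k < ℓ, π ^ k ≠ 0) : ∀ k ≤ ℓ,
    (Ideal.span {π ^ k}).toAddSubgroup.index = residueCard R ^ k := by
  intro k
  induction k with
  | zero =>
    intro _
    simp
  | succ k ih =>
    intro hk
    rw [← AddSubgroup.relIndex_mul_index (K := (Ideal.span {π ^ k}).toAddSubgroup),
      hπ.relIndex_span_pow (hℓ k hk), ih (by omega), pow_succ']
    exact Ideal.span_singleton_le_span_singleton.2 (pow_dvd_pow π k.le_succ)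

lemma IsUniformizer.card_eq {π : R} (hπ : IsUniformizer π) {ℓ : ℕ}
    (hℓ : IsLeast {k : ℕ | 0 < k ∧ π ^ k = 0} ℓ) : Nat.card R = residueCard R ^ ℓ := by
  have hne : ∀ k < ℓ, π ^ k ≠ 0 := by
    intro k hk h
    rcases Nat.eq_zero_or_pos k with rfl | hpos
    · simp at h
    · exact absurd (hℓ.2 ⟨hpos, h⟩) (by omega)
  have h := hπ.index_span_pow hne ℓ le_rfl
  rw [hℓ.1.2] at h
  simpa using h

/-- A nonzero element has at most `q ^ (ℓ - 1)` annihilating elements. -/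
lemma IsUniformizer.card_annihilator_mul_le [Finite R] {π : R} (hπ : IsUniformizer π) {ℓ : ℕ}
    (hℓ : IsLeast {k : ℕ | 0 < k ∧ π ^ k = 0} ℓ) {s : R} (hs : s ≠ 0) :
    Nat.card {x : R // s * x = 0} ≤ residueCard R ^ (ℓ - 1) := by
  have hm := Submodule.card_eq_card_quotient_mul_card (IsLocalRing.maximalIdeal R)
  have hq : Nat.card (R ⧸ IsLocalRing.maximalIdeal R) = residueCard R := rfl
  have hpos : 0 < residueCard R := residueCard_pos
  have hcard : Nat.card (IsLocalRing.maximalIdeal R) = residueCard R ^ (ℓ - 1) := by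
    rw [hπ.card_eq hℓ, ← Nat.succ_pred_eq_of_pos hℓ.1.1, Nat.succ_eq_add_one, pow_succ',
      hq] at hm
    exact (Nat.eq_of_mul_eq_mul_left hpos (by simpa [mul_comm] using hm)).symm
  rw [← hcard]
  refine Nat.card_le_card_of_injective
    (fun x : {x : R // s * x = 0} => (⟨x.1, ?_⟩ : IsLocalRing.maximalIdeal R)) ?_
  -- A unit cannot annihilate `s ≠ 0`.
  · rw [IsLocalRing.mem_maximalIdeal, mem_nonunits_iff]
    exact fun hx => hs (hx.mul_left_eq_zero.1 x.2)
  · intro x y h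
    exact Subtype.ext (congrArg (fun z : IsLocalRing.maximalIdeal R => (z : R)) h)

/-- Every nonzero element divides the generator of the socle. -/
lemma IsUniformizer.dvd_pow_pred {π : R} (hπ : IsUniformizer π) {ℓ : ℕ}
    (hℓ : IsLeast {k : ℕ | 0 < k ∧ π ^ k = 0} ℓ) {s : R} (hs : s ≠ 0) : s ∣ π ^ (ℓ - 1) := by
  classical
  have hex : ∃ k, ¬ π ^ k ∣ s := ⟨ℓ, fun h => hs (by rwa [hℓ.1.2, zero_dvd_iff] at h)⟩
  have hfind := Nat.find_spec hex
  have hle : Nat.find hex ≤ ℓ :=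
    Nat.find_min' hex fun h => hs (by rwa [hℓ.1.2, zero_dvd_iff] at h)
  obtain ⟨j, hj⟩ : ∃ j, Nat.find hex = j + 1 :=
    Nat.exists_eq_succ_of_ne_zero fun h => by simp [h] at hfind
  obtain ⟨u, hu⟩ : π ^ j ∣ s := not_not.1 (Nat.find_min hex (m := j) (by omega))
  rw [hj] at hfind
  have hunit : IsUnit u := by
    by_contra h
    obtain ⟨v, rfl⟩ := (hπ.mem_iff u).1 h
    exact hfind ⟨v, by rw [hu]; ring⟩
  rw [hu, hunit.mul_right_dvd]
  exact pow_dvd_pow π (by omega)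

/-- Every nonzero ideal contains `π ^ (ℓ - 1)`, so a character nontrivial at this one element stays
nontrivial under every nonzero multiplicative shift. -/
lemma IsUniformizer.exists_isPrimitive [Finite R] {π : R} (hπ : IsUniformizer π) {ℓ : ℕ}
    (hℓ : IsLeast {k : ℕ | 0 < k ∧ π ^ k = 0} ℓ) : ∃ ψ : AddChar R ℂ, ψ.IsPrimitive := by
  have hne : π ^ (ℓ - 1) ≠ 0 := by
    intro h
    rcases Nat.eq_zero_or_pos (ℓ - 1) with h0 | hpos
    · simp [h0] at h
    · exact absurd (hℓ.2 ⟨hpos, h⟩) (by have := hℓ.1.1; omega)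
  obtain ⟨ψ, hψ⟩ := AddChar.exists_apply_ne_zero.2 hne
  refine ⟨ψ, fun s hs h => hψ ?_⟩
  obtain ⟨u, hu⟩ := hπ.dvd_pow_pred hℓ hs
  simpa [hu] using DFunLike.congr_fun h u

end FiniteValuationRing

/-! ### Exponential sums of dot products. -/

section CharacterSums

variable {R : Type*} [CommRing R] [Fintype R] [DecidableEq R] {n : ℕ}

lemma AddChar.IsPrimitive.sum_dotProduct {ψ : AddChar R ℂ} (hψ : ψ.IsPrimitive)
    (c : Fin n → R) :
    ∑ a : Fin n → R, ψ (a ⬝ᵥ c) = if c = 0 then (Fintype.card R : ℂ) ^ n else 0 := by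
  have hprod (a : Fin n → R) : ψ (a ⬝ᵥ c) = ∏ i, ψ (a i * c i) := by
    simp only [dotProduct]
    induction (univ : Finset (Fin n)) using Finset.induction_on with
    | empty => simp
    | insert i t hi ih => rw [sum_insert hi, prod_insert hi, AddChar.map_add_eq_mul, ih]
  simp_rw [hprod]
  rw [← Fintype.piFinset_univ, sum_prod_piFinset (univ : Finset R) fun i x => ψ (x * c i)]
  simp_rw [AddChar.sum_mulShift _ hψ]
  split_ifs with hc
  · simp [hc]
  · obtain ⟨i, hi⟩ := Function.ne_iff.1 hc
    exact prod_eq_zero (mem_univ i) (by simpa using hi)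

lemma card_filter_smul_sub_eq_zero_le (s : R) (b : Fin n → R) (B : Finset (Fin n → R)) :
    #{b' ∈ B | s • (b - b') = 0} ≤ Nat.card {x : R // s * x = 0} ^ n := by
  rw [← Fintype.card_coe, ← Nat.card_eq_fintype_card]
  have hpow : Nat.card {x : R // s * x = 0} ^ n =
      Nat.card (Fin n → {x : R // s * x = 0}) := by simp
  rw [hpow]
  refine Nat.card_le_card_of_injective
    (fun b' i => ⟨b i - b'.1 i, by
      simpa using congrFun (mem_filter.1 b'.2).2 i⟩) ?_
  intro x y h
  refine Subtype.ext (funext fun i => ?_)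
  simpa using congrArg Subtype.val (congrFun h i)

/-- The second moment of the exponential sums over `B` with frequency `s`. -/
lemma AddChar.IsPrimitive.sum_norm_sq_le {ψ : AddChar R ℂ} (hψ : ψ.IsPrimitive) (s : R)
    (B : Finset (Fin n → R)) :
    ∑ a : Fin n → R, ‖∑ b ∈ B, ψ (s * (a ⬝ᵥ b))‖ ^ 2 ≤
      (#B : ℝ) * ((Fintype.card R : ℝ) ^ n * (Nat.card {x : R // s * x = 0} : ℝ) ^ n) := by
  have hexpand : ((∑ a : Fin n → R, ‖∑ b ∈ B, ψ (s * (a ⬝ᵥ b))‖ ^ 2 : ℝ) : ℂ) =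
      ((∑ b ∈ B, (#{b' ∈ B | s • (b - b') = 0} : ℝ) * (Fintype.card R : ℝ) ^ n : ℝ) : ℂ) := by
    have hterm (a : Fin n → R) : (‖∑ b ∈ B, ψ (s * (a ⬝ᵥ b))‖ : ℂ) ^ 2 =
        ∑ b ∈ B, ∑ b' ∈ B, ψ (a ⬝ᵥ (s • (b - b'))) := by
      rw [← Complex.mul_conj', map_sum, sum_mul_sum]
      refine sum_congr rfl fun b _ => sum_congr rfl fun b' _ => ?_
      rw [← AddChar.map_neg_eq_conj, ← AddChar.map_add_eq_mul, dotProduct_smul, dotProduct_sub,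
        smul_eq_mul]
      congr 1
      ring
    push_cast
    simp_rw [hterm]
    rw [sum_comm]
    refine sum_congr rfl fun b _ => ?_
    rw [sum_comm]
    simp_rw [hψ.sum_dotProduct]
    rw [← sum_filter, sum_const, nsmul_eq_mul]
  rw [Complex.ofReal_inj.1 hexpand, ← nsmul_eq_mul]
  refine sum_le_card_nsmul _ _ _ fun b _ => ?_
  rw [mul_comm]
  gcongr
  exact_mod_cast card_filter_smul_sub_eq_zero_le s b B

lemma AddChar.IsPrimitive.norm_sum_sum_le {ψ : AddChar R ℂ} (hψ : ψ.IsPrimitive) (s : R)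
    (A B : Finset (Fin n → R)) :
    ‖∑ a ∈ A, ∑ b ∈ B, ψ (s * (a ⬝ᵥ b))‖ ^ 2 ≤
      (#A : ℝ) * (#B : ℝ) *
        ((Fintype.card R : ℝ) ^ n * (Nat.card {x : R // s * x = 0} : ℝ) ^ n) := by
  calc ‖∑ a ∈ A, ∑ b ∈ B, ψ (s * (a ⬝ᵥ b))‖ ^ 2
      ≤ (∑ a ∈ A, ‖∑ b ∈ B, ψ (s * (a ⬝ᵥ b))‖) ^ 2 := by gcongr; exact norm_sum_le _ _
    _ ≤ #A * ∑ a ∈ A, ‖∑ b ∈ B, ψ (s * (a ⬝ᵥ b))‖ ^ 2 := sq_sum_le_card_mul_sum_sq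
    -- Positivity allows completing the sum to all of `R ^ n`, where orthogonality applies.
    _ ≤ #A * ∑ a : Fin n → R, ‖∑ b ∈ B, ψ (s * (a ⬝ᵥ b))‖ ^ 2 := by
        gcongr
        exact A.subset_univ
    _ ≤ _ := by
        rw [mul_assoc]
        gcongr
        exact hψ.sum_norm_sq_le s B

/-- Fourier expansion of `N_r(A, B)`, with the main term separated. -/
lemma AddChar.IsPrimitive.card_mul_dotCount_sub {ψ : AddChar R ℂ} (hψ : ψ.IsPrimitive) (r : R)
    (A B : Finset (Fin n → R)) :
    (Fintype.card R : ℂ) * dotCount r A B - #A * #B =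
      ∑ s ∈ univ.erase (0 : R), ψ (-(s * r)) * ∑ a ∈ A, ∑ b ∈ B, ψ (s * (a ⬝ᵥ b)) := by
  have hsum : (Fintype.card R : ℂ) * dotCount r A B =
      ∑ s : R, ψ (-(s * r)) * ∑ a ∈ A, ∑ b ∈ B, ψ (s * (a ⬝ᵥ b)) := by
    have hind (x : R) : ∑ s : R, ψ (-(s * r)) * ψ (s * x) =
        if x = r then (Fintype.card R : ℂ) else 0 := by
      have h := AddChar.sum_mulShift (x - r) hψ
      simp only [sub_eq_zero] at h
      rw [Nat.cast_ite, Nat.cast_zero] at h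
      rw [← h]
      refine sum_congr rfl fun s _ => ?_
      rw [← AddChar.map_add_eq_mul]
      congr 1
      ring
    simp_rw [mul_sum]
    rw [sum_comm]
    simp_rw [sum_comm (s := (univ : Finset R)), hind]
    rw [dotCount, ← sum_product' A B fun a b => if a ⬝ᵥ b = r then (Fintype.card R : ℂ) else 0,
      ← sum_filter, sum_const, nsmul_eq_mul, mul_comm]
  rw [hsum, ← add_sum_erase _ _ (mem_univ (0 : R))]
  simp

end CharacterSums

/-! ### The counting bound and its consequence. -/

lemma IsUniformizer.abs_dotCount_sub_lt {R : Type*} [CommRing R] [Finite R] [DecidableEq R]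
    [IsLocalRing R] {π : R} (hπ : IsUniformizer π) {ℓ : ℕ}
    (hℓ : IsLeast {k : ℕ | 0 < k ∧ π ^ k = 0} ℓ) {n : ℕ}
    {A B : Finset (Fin n → R)} (hA : A.Nonempty) (hB : B.Nonempty) (r : R) :
    |(dotCount r A B : ℝ) -
        (residueCard R : ℝ) ^ (-(ℓ : ℝ)) * (A.card : ℝ) * (B.card : ℝ)|
      < (residueCard R : ℝ) ^ ((n : ℝ) * ((ℓ : ℝ) - 1 / 2)) *
        √((A.card : ℝ) * (B.card : ℝ)) := by
  have := Fintype.ofFinite R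
  obtain ⟨ψ, hψ⟩ := hπ.exists_isPrimitive hℓ
  have hcard : (Fintype.card R : ℝ) = (residueCard R : ℝ) ^ ℓ := by
    exact_mod_cast Nat.card_eq_fintype_card (α := R) ▸ hπ.card_eq hℓ
  have hann (s : R) (hs : s ≠ 0) :
      (Nat.card {x : R // s * x = 0} : ℝ) ≤ (residueCard R : ℝ) ^ (ℓ - 1) := by
    exact_mod_cast hπ.card_annihilator_mul_le hℓ hs
  have hq : (0 : ℝ) < residueCard R := by
    exact_mod_cast residueCard_pos (R := R)
  set q : ℝ := (residueCard R : ℝ)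
  set M : ℝ := q ^ ((n : ℝ) * ((ℓ : ℝ) - 1 / 2)) * √((#A : ℝ) * (#B : ℝ)) with hM
  have hAB : (0 : ℝ) < #A * #B := by
    have := hA.card_pos
    have := hB.card_pos
    positivity
  have hMpos : 0 < M := by positivity
  -- The exponent `ℓ - 1 / 2` is the mean of `ℓ` and `ℓ - 1`.
  have hMsq : M ^ 2 = #A * #B * ((q ^ ℓ) ^ n * (q ^ (ℓ - 1)) ^ n) := by
    rw [hM, mul_pow, Real.sq_sqrt hAB.le, ← Real.rpow_mul_natCast hq.le, mul_comm, ← pow_mul,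
      ← pow_mul, ← pow_add, ← Real.rpow_natCast q (ℓ * n + _)]
    congr 2
    push_cast [Nat.cast_sub (show 1 ≤ ℓ from hℓ.1.1)]
    ring
  have hT : ∀ s ∈ univ.erase (0 : R),
      ‖ψ (-(s * r)) * ∑ a ∈ A, ∑ b ∈ B, ψ (s * (a ⬝ᵥ b))‖ ≤ M := by
    intro s hs
    rw [norm_mul, AddChar.norm_apply, one_mul]
    refine le_of_sq_le_sq ?_ hMpos.le
    refine (hψ.norm_sum_sum_le s A B).trans ?_
    rw [hMsq, hcard]
    gcongr
    exact hann s (ne_of_mem_erase hs)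
  have hmain : |(Fintype.card R : ℝ) * dotCount r A B - #A * #B| ≤
      ((Fintype.card R : ℝ) - 1) * M := by
    have hsum := norm_sum_le_of_le _ hT
    rw [← hψ.card_mul_dotCount_sub, sum_const, card_erase_of_mem (mem_univ _), card_univ,
      nsmul_eq_mul, Nat.cast_sub Fintype.card_pos, Nat.cast_one] at hsum
    rw [← Real.norm_eq_abs, ← Complex.norm_real]
    push_cast
    exact hsum
  have hRpos : (0 : ℝ) < Fintype.card R := by exact_mod_cast Fintype.card_pos
  have hinv : q ^ (-(ℓ : ℝ)) = (Fintype.card R : ℝ)⁻¹ := by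
    rw [Real.rpow_neg hq.le, Real.rpow_natCast, hcard]
  refine lt_of_mul_lt_mul_left ?_ hRpos.le
  rw [← abs_of_pos hRpos, ← abs_mul, abs_of_pos hRpos, hinv, mul_sub]
  have hcancel : (Fintype.card R : ℝ) * ((Fintype.card R : ℝ)⁻¹ * #A * #B) = #A * #B := by
    field_simp
  rw [hcancel]
  -- Strictness: only `|R| - 1` frequencies are nonzero, and `M > 0`.
  refine hmain.trans_lt ?_
  linarith

theorem mainTheorem5 {R : Type*} [CommRing R] [Finite R] [DecidableEq R]
    [IsLocalRing R] [IsPrincipalIdealRing R]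
    (π : R) (hπ : IsUniformizer π)
    (q ℓ : ℕ) (hq : q = residueCard R) (hodd : Odd q)
    (hℓ : IsLeast {k : ℕ | 0 < k ∧ π ^ k = 0} ℓ)
    (n : ℕ) (hn : 2 ≤ n)
    (A B : Finset (Fin n → R)) (hA : A.Nonempty) (hB : B.Nonempty) :
    (∀ r : R,
      |(dotCount r A B : ℝ) - (q : ℝ) ^ (-(ℓ : ℝ)) * (A.card : ℝ) * (B.card : ℝ)|
        < (q : ℝ) ^ ((n : ℝ) * ((ℓ : ℝ) - 1 / 2)) * √((A.card : ℝ) * (B.card : ℝ))) ∧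
    ((q : ℝ) ^ (-((n : ℝ) - 2 * (ℓ : ℝ))) ≤ density A * density B →
      dotSet A B = Set.univ) := by
  have hcard : Nat.card R = q ^ ℓ := by rw [hq, hπ.card_eq hℓ]
  have hq0 : (0 : ℝ) < q := by exact_mod_cast hodd.pos
  have hbound : ∀ r : R,
      |(dotCount r A B : ℝ) - (q : ℝ) ^ (-(ℓ : ℝ)) * (A.card : ℝ) * (B.card : ℝ)|
        < (q : ℝ) ^ ((n : ℝ) * ((ℓ : ℝ) - 1 / 2)) * √((A.card : ℝ) * (B.card : ℝ)) := by
    subst hq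
    exact hπ.abs_dotCount_sub_lt hℓ hA hB
  refine ⟨hbound, fun hδ => Set.eq_univ_of_forall fun r => ?_⟩
  -- The density hypothesis says, after squaring, that the error is at most the main term; the
  -- strict bound then excludes a zero count.
  have hlarge : (q : ℝ) ^ ((n : ℝ) * ((ℓ : ℝ) - 1 / 2)) ≤
      (q : ℝ) ^ (-(ℓ : ℝ)) * √((#A : ℝ) * (#B : ℝ)) := by
    have hdens : density A * density B =
        (q : ℝ) ^ (-(2 * (n : ℝ) * ℓ)) * ((#A : ℝ) * (#B : ℝ)) := by
      have hvec : (Nat.card (Fin n → R) : ℝ) = (q : ℝ) ^ ((n : ℝ) * ℓ) := by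
        rw [Nat.card_fun, Nat.card_fin, hcard]
        push_cast
        rw [← pow_mul, ← Real.rpow_natCast]
        push_cast
        rw [mul_comm]
      rw [density, density, hvec, Real.rpow_neg hq0.le, div_mul_div_comm,
        ← Real.rpow_add hq0, div_eq_inv_mul]
      ring_nf
    rw [hdens] at hδ
    refine le_of_sq_le_sq ?_ (by positivity)
    rw [mul_pow, Real.sq_sqrt (by positivity), ← Real.rpow_mul_natCast hq0.le,
      ← Real.rpow_mul_natCast hq0.le]
    calc (q : ℝ) ^ ((n : ℝ) * ((ℓ : ℝ) - 1 / 2) * (2 : ℕ))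
        = (q : ℝ) ^ (2 * (n : ℝ) * ℓ - 2 * ℓ) * (q : ℝ) ^ (-((n : ℝ) - 2 * ℓ)) := by
          rw [← Real.rpow_add hq0]
          congr 1
          push_cast
          ring
      _ ≤ (q : ℝ) ^ (2 * (n : ℝ) * ℓ - 2 * ℓ) *
            ((q : ℝ) ^ (-(2 * (n : ℝ) * ℓ)) * ((#A : ℝ) * (#B : ℝ))) := by gcongr
      _ = _ := by
          rw [← mul_assoc, ← Real.rpow_add hq0]
          congr 2
          push_cast
          ring
  have hpos : 0 < dotCount r A B := by
    by_contra h
    have h0 : dotCount r A B = 0 := by omega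
    have hb := hbound r
    rw [h0, Nat.cast_zero, zero_sub, abs_neg, abs_of_nonneg (by positivity), mul_assoc] at hb
    have := mul_le_mul_of_nonneg_right hlarge (Real.sqrt_nonneg ((#A : ℝ) * (#B : ℝ)))
    rw [mul_assoc, Real.mul_self_sqrt (by positivity)] at this
    linarith
  obtain ⟨p, hp⟩ := card_pos.1 hpos
  obtain ⟨hmem, heq⟩ := mem_filter.1 hp
  exact ⟨p.1, (mem_product.1 hmem).1, p.2, (mem_product.1 hmem).2, heq⟩
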